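/- Let $M\in[-1,1]^{m\times N}$ ($m,N\ge 1$) be a feature matrix, $M_{ij}=y_i h_j(x_i)$ for training examples $(x_i,y_i)$, $y_i\in\{-1,1\}$, and weak hypotheses $h_j$ with values in $[-1,1]$. For $\lambda\in\mathbb{R}^N$ let $L(\lambda)=\frac1m\sum_{i=1}^m e^{-(M\lambda)_i}$ be the exponential loss. AdaBoost starts with $\lambda^0=0$ and $D_1(i)=1/m$; in round $t\ge1$ it chooses $j_t\in\arg\max_j\left|\sum_i D_t(i)M_{ij}\right|$ (ties broken arbitrarily), puts $r_t=\sum_i D_t(i)M_{ij_t}$ and $\alpha_t=\frac12\ln\frac{1+r_t}{1-r_t}$, and sets $\lambda^t=\lambda^{t-1}+\alpha_t e_{j_t}$ and $D_{t+1}(i)=D_t(i)e^{-\alpha_t M_{ij_t}}/Z_t$, where $Z_t$ normalizes $D_{t+1}$ to a distribution. If $|r_t|=1$, the step is infinite, the loss after round $t$ is understood as the limit of the loss along this step, which is $0$, and the algorithm stops (its loss then remains $0$). Theorem. (a) There is a constant $C>0$ depending only on $M$ such that for every $\varepsilon>0$ every execution of AdaBoost attains a loss of at most $\inf_{\lambda}L(\lambda)+\varepsilon$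 after at most $C/\varepsilon$ rounds. (b) There are a partition $\{1,\dots,m\}=Z\sqcup F$ and constants $0<\gamma\le1$, $\mu_{\max}\ge0$ such that: (1) if $Z\ne\emptyset$, there is $\eta^\dagger\in\mathbb{R}^N$ with $\|\eta^\dagger\|_1=1$, $(M\eta^\dagger)_i\ge\gamma$ for $i\in Z$ and $(M\eta^\dagger)_i=0$ for $i\in F$; (2) $\eta\mapsto\sum_{i\in F}e^{-(M\eta)_i}$ attains its infimum on $\mathbb{R}^N$; (3) whenever $\sum_{i\in F}e^{-(M\eta)_i}\le m$, then $(M\eta)_i\in[-\ln m,\mu_{\max}]$ for all $i\in F$. (c) For all $Z,F,\gamma,\mu_{\max}$ as in (b), the constant $$C=\frac{32\,m^3N\,e^{\mu_{\max}}}{\gamma^2\lambda_{\min}^2}$$ can be taken in (a), where $\lambda_{\min}^2$ is the smallest positive eigenvalue of $M_F^{T}M_F$, $M_F$ being the submatrix of $M$ formed by the rows in $F$ (with $\lambda_{\min}=1$ if there is no positive eigenvalue, i.e. if $F=\emptyset$ or $M_F=0$). -/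

import Mathlib

open Filter Topology

noncomputable section

namespace AdaBoost

variable {m N : ℕ}

/-- The exponential loss on example `i` of the combination `lam`: `e^{-(M lam)_i}`. -/
def exampleLoss (M : Matrix (Fin m) (Fin N) ℝ) (lam : Fin N → ℝ) (i : Fin m) : ℝ :=
  Real.exp (-(M.mulVec lam i))

/-- The (normalized) exponential loss `L(lam) = (1/m) ∑ᵢ e^{-(M lam)_i}`. -/
def expLoss (M : Matrix (Fin m) (Fin N) ℝ) (lam : Fin N → ℝ) : ℝ :=
  (1 / (m : ℝ)) * ∑ i, exampleLoss M lam i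

/-- The correlation `𝔼_{i ∼ D}[M i k]` of hypothesis `k` under the weights `D`. -/
def correlation (M : Matrix (Fin m) (Fin N) ℝ) (D : Fin m → ℝ) (k : Fin N) : ℝ :=
  ∑ i, D i * M i k

/-- The step size `α = (1/2) ln((1+r)/(1-r))`, meaningful for `|r| < 1`. -/
def stepSize (r : ℝ) : ℝ := (1 / 2) * Real.log ((1 + r) / (1 - r))

/-- An execution of AdaBoost with feature matrix `M i k = y_i h_k(x_i)`. Indices are shifted by one:
`D t` and `j t` are the distribution and the hypothesis used in round `t + 1`, and `lam t` is the
combination of hypotheses after `t` rounds. Ties in the choice of `j t` are broken arbitrarily.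
If the correlation in some round is `±1`, the step size is infinite and the execution is over
after this round; nothing is required of the later entries of the sequences `lam`, `D` (see
`Run.lossAfter`). -/
structure Run (M : Matrix (Fin m) (Fin N) ℝ) where
  D : ℕ → Fin m → ℝ
  j : ℕ → Fin N
  lam : ℕ → Fin N → ℝ
  D_zero : ∀ i, D 0 i = 1 / (m : ℝ)
  lam_zero : lam 0 = 0
  greedy : ∀ t k, |correlation M (D t) k| ≤ |correlation M (D t) (j t)|
  lam_succ : ∀ t, |correlation M (D t) (j t)| < 1 →
    lam (t + 1) = lam t + Pi.single (j t) (stepSize (correlation M (D t) (j t)))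
  D_succ : ∀ t, |correlation M (D t) (j t)| < 1 → ∀ i,
    D (t + 1) i =
      D t i * Real.exp (-(stepSize (correlation M (D t) (j t)) * M i (j t))) /
        ∑ k, D t k * Real.exp (-(stepSize (correlation M (D t) (j t)) * M k (j t)))

/-- The correlation `r_{t+1}` of the hypothesis chosen in round `t + 1`. -/
def Run.r {M : Matrix (Fin m) (Fin N) ℝ} (R : Run M) (t : ℕ) : ℝ :=
  correlation M (R.D t) (R.j t)

/-- If the chosen hypothesis has correlation `r = ±1` under a positive distribution, then the loss
tends to zero along the infinite step `r · ∞` in its direction. -/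
theorem tendsto_expLoss_of_abs_correlation_eq_one (M : Matrix (Fin m) (Fin N) ℝ)
    (hM : ∀ i k, |M i k| ≤ 1) (D : Fin m → ℝ) (hD : ∀ i, 0 < D i) (hD1 : ∑ i, D i = 1)
    (k : Fin N) (hr : |correlation M D k| = 1) (lam : Fin N → ℝ) :
    Tendsto (fun c : ℝ => expLoss M (lam + Pi.single k (c * correlation M D k))) atTop (𝓝 0) := by
  set r := correlation M D k with hrdef
  have hrr : r * r = 1 := by
    have := abs_mul_abs_self r
    rw [hr] at this
    linarith
  have hle : ∀ i, r * M i k ≤ 1 := fun i => by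
    calc r * M i k ≤ |r * M i k| := le_abs_self _
      _ = |M i k| := by rw [abs_mul, hr, one_mul]
      _ ≤ 1 := hM i k
  have hsum : ∑ i, D i * (1 - r * M i k) = 0 := by
    have h1 : ∑ i, D i * (1 - r * M i k) = ∑ i, D i - r * ∑ i, D i * M i k := by
      rw [Finset.mul_sum, ← Finset.sum_sub_distrib]
      exact Finset.sum_congr rfl fun i _ => by ring
    have h2 : ∑ i, D i * M i k = r := rfl
    rw [h1, h2, hD1, hrr, sub_self]
  have hone : ∀ i, r * M i k = 1 := fun i => by
    have h0 := (Finset.sum_eq_zero_iff_of_nonneg (fun i _ =>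
      mul_nonneg (hD i).le (sub_nonneg.2 (hle i)))).1 hsum i (Finset.mem_univ i)
    rcases mul_eq_zero.1 h0 with h | h
    · exact absurd h (hD i).ne'
    · linarith
  have key : ∀ i, Tendsto (fun c : ℝ => exampleLoss M (lam + Pi.single k (c * r)) i)
      atTop (𝓝 0) := fun i => by
    have he : (fun c : ℝ => exampleLoss M (lam + Pi.single k (c * r)) i) =
        fun c : ℝ => Real.exp (-(M.mulVec lam i + c)) := by
      funext c
      have : M i k * (c * r) = c := by
        calc M i k * (c * r) = c * (r * M i k) := by ring
          _ = c := by rw [hone i, mul_one]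
      simp [exampleLoss, Matrix.mulVec_add, this]
    rw [he]
    exact Real.tendsto_exp_neg_atTop_nhds_zero.comp (tendsto_atTop_add_const_left _ _ tendsto_id)
  have := (tendsto_finsetSum Finset.univ fun i _ => key i).const_mul (1 / (m : ℝ))
  simpa [expLoss] using this

open Classical in
/-- The exponential loss after `t` rounds. If one of these rounds had correlation `±1`, hence
step size `±∞`, this is the limit of the loss along the infinite step, which is zero by
`tendsto_expLoss_of_abs_correlation_eq_one`. -/
def Run.lossAfter {M : Matrix (Fin m) (Fin N) ℝ} (R : Run M) (t : ℕ) : ℝ :=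
  if ∃ s < t, |R.r s| = 1 then 0 else expLoss M (R.lam t)

/-- For every `ε > 0`, every execution of AdaBoost comes within `ε` of the infimal exponential
loss after at most `C / ε` rounds. -/
def ReachesOptimumWithin (M : Matrix (Fin m) (Fin N) ℝ) (C : ℝ) : Prop :=
  ∀ ε : ℝ, 0 < ε → ∀ R : Run M,
    ∃ t : ℕ, (t : ℝ) ≤ C / ε ∧ R.lossAfter t ≤ (⨅ lam : Fin N → ℝ, expLoss M lam) + ε

/-- `Z` is a zero-loss set with finite-margin set `F = Zᶜ`, and `γ`, `μmax` are admissible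
constants. For `Z ≠ ∅` the bound `γ ≤ 1` follows from `margin` (when the entries of `M` lie in
`[-1,1]`), and for `F ≠ ∅` the bound `0 ≤ μmax` follows from `bounded` (take `η = 0`); in the
remaining cases the constants are otherwise unconstrained and these bounds normalize them. -/
structure IsDecomposition (M : Matrix (Fin m) (Fin N) ℝ) (Z : Finset (Fin m)) (γ μmax : ℝ) :
    Prop where
  gamma_pos : 0 < γ
  gamma_le_one : γ ≤ 1
  mu_nonneg : 0 ≤ μmax
  margin : Z.Nonempty → ∃ η : Fin N → ℝ, ∑ k, |η k| = 1 ∧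
    (∀ i ∈ Z, γ ≤ M.mulVec η i) ∧ ∀ i ∈ Zᶜ, M.mulVec η i = 0
  optimal : ∃ ηstar : Fin N → ℝ, ∀ η : Fin N → ℝ,
    ∑ i ∈ Zᶜ, exampleLoss M ηstar i ≤ ∑ i ∈ Zᶜ, exampleLoss M η i
  bounded : ∀ η : Fin N → ℝ, ∑ i ∈ Zᶜ, exampleLoss M η i ≤ (m : ℝ) →
    ∀ i ∈ Zᶜ, -Real.log (m : ℝ) ≤ M.mulVec η i ∧ M.mulVec η i ≤ μmax

/-- The rows of `M` outside of `Z`, i.e. `M_F` for `F = Zᶜ`. -/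
def restrictRows (M : Matrix (Fin m) (Fin N) ℝ) (Z : Finset (Fin m)) :
    Matrix {i : Fin m // i ∈ Zᶜ} (Fin N) ℝ :=
  M.submatrix Subtype.val id

/-- The positive eigenvalues of `M_Fᵀ M_F`, where `F = Zᶜ`. -/
def posEigenvalues (M : Matrix (Fin m) (Fin N) ℝ) (Z : Finset (Fin m)) : Set ℝ :=
  {x | 0 < x ∧ Module.End.HasEigenvalue
    (Matrix.toLin' ((restrictRows M Z).transpose * restrictRows M Z)) x}

open Classical in
/-- `λ_min²`, the smallest positive eigenvalue of `M_Fᵀ M_F` (a minimum over a finite set);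
by convention `1` if there is none, i.e. if `F` is empty or `M_F = 0`. -/
def lambdaMinSq (M : Matrix (Fin m) (Fin N) ℝ) (Z : Finset (Fin m)) : ℝ :=
  if (posEigenvalues M Z).Nonempty then sInf (posEigenvalues M Z) else 1

end AdaBoost

end

/-!
Write `ℓᵢ = e^{-(M λ)ᵢ}`, `S = ∑ᵢ ℓᵢ`, `g = Mᵀ ℓ`, and let `K` be the minimum of the loss on
`F = Zᶜ` alone, so that `K / m` is a lower bound for the infimal loss.

*Progress of a round.* As long as no step is infinite, `D_t = ℓ / S`
(`AdaBoost.Run.D_eq`). Hence the greedy choice gives `S |r_t| = ‖g‖_∞`, and convexity of the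
exponential gives `S_{t+1} ≤ S_t (1 - r_t² / 2)`, that is, a decrease of `‖g‖_∞² / (2 S)`.

*Lower bound on the gradient.* Put `κ = e^{-μmax} λ_min²`. Pairing `g` with the direction of
margin `γ` on `Z` and `0` on `F` yields `γ ℓ(Z) ≤ ‖g‖_∞`. Since the margins on `F` never exceed
`μmax`, the loss on `F` is strongly convex in these margins, and after passing through the singular
values of `M_F` this becomes a Polyak-Łojasiewicz inequality `2 κ (ℓ(F) - K) ≤ N ‖M_Fᵀ ℓ_F‖_∞²`
(`AdaBoost.IsDecomposition.suboptimality_le`). As `‖M_Fᵀ ℓ_F‖_∞ ≤ ‖g‖_∞ + ℓ(Z)`, the two combine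
to `γ² κ (S - K)² ≤ 6 N m ‖g‖_∞²` (`AdaBoost.IsDecomposition.gradient_bound`).

*Rate.* The suboptimality `d_t = (S_t - K) / m` therefore satisfies `d_{t+1} ≤ d_t - c d_t²` with
`c = γ² κ / (12 N m)`, which forces `d_t ≤ 1 / (1 + c t)`. This even gives the constant
`12 m N e^{μmax} / (γ² λ_min²)`.

*Existence of a decomposition.* Let `Z` consist of the examples on which some combination with
`M η ≥ 0` has a positive margin; a sum of such combinations is positive on exactly `Z`. By
maximality, `M_F η ≥ 0` implies `M_F η = 0`, and so by compactness of the unit sphere of the range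
of `M_F` a lower bound on the margins in `F` bounds them from above as well
(`AdaBoost.exists_bound_abs_mulVec`). In particular the sublevel sets of the loss on `F`, as a
function of the margins, are compact.
-/

namespace AdaBoost

variable {m N : ℕ}

/-! ### Inequalities for the exponential function and the step size -/

/-- The chord of `x ↦ e^{-a x}` over `[-1, 1]` lies above the graph. -/
theorem exp_neg_mul_le (a : ℝ) {x : ℝ} (hx : |x| ≤ 1) :
    Real.exp (-(a * x)) ≤ (1 + x) / 2 * Real.exp (-a) + (1 - x) / 2 * Real.exp a := by
  obtain ⟨h1, h2⟩ := abs_le.1 hx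
  have h := convexOn_exp.2 (Set.mem_univ (-a)) (Set.mem_univ a)
    (show (0 : ℝ) ≤ (1 + x) / 2 by linarith) (show (0 : ℝ) ≤ (1 - x) / 2 by linarith) (by ring)
  simp only [smul_eq_mul] at h
  rwa [show (1 + x) / 2 * -a + (1 - x) / 2 * a = -(a * x) by ring] at h

/-- The step size minimizes the left-hand side over the step, with minimum `√(1 - r²)`. -/
theorem stepSize_bound {r : ℝ} (hr : |r| < 1) :
    (1 + r) / 2 * Real.exp (-stepSize r) + (1 - r) / 2 * Real.exp (stepSize r) ≤
      1 - r ^ 2 / 2 := by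
  obtain ⟨h1, h2⟩ := abs_lt.1 hr
  have hp : 0 < 1 + r := by linarith
  have hq : 0 < 1 - r := by linarith
  set E := Real.exp (stepSize r) with hE
  have hE0 : 0 < E := Real.exp_pos _
  have hsq : E ^ 2 * (1 - r) = 1 + r := by
    have : E ^ 2 = (1 + r) / (1 - r) := by
      rw [hE, ← Real.exp_nat_mul, stepSize, ← mul_assoc]
      norm_num
      exact Real.exp_log (div_pos hp hq)
    rw [this, div_mul_cancel₀ _ hq.ne']
  have hval : (1 + r) / 2 * Real.exp (-stepSize r) + (1 - r) / 2 * E = (1 - r) * E := by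
    rw [Real.exp_neg, ← hE, ← hsq]
    field_simp
    ring
  rw [hval]
  refine abs_le_of_sq_le_sq' ?_ (by nlinarith) |>.2
  have : ((1 - r) * E) ^ 2 = 1 - r ^ 2 := by
    calc ((1 - r) * E) ^ 2 = (E ^ 2 * (1 - r)) * (1 - r) := by ring
      _ = _ := by rw [hsq]; ring
  nlinarith [sq_nonneg (r ^ 2)]

/-- On `(-∞, c]` the function `y ↦ e^{-y}` is strongly convex with modulus `e^{-c}`. -/
theorem exp_neg_strongConvex {a b c : ℝ} (ha : a ≤ c) (hb : b ≤ c) :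
    Real.exp (-a) - Real.exp (-a) * (b - a) + Real.exp (-c) / 2 * (b - a) ^ 2 ≤
      Real.exp (-b) := by
  obtain ⟨x, rfl⟩ : ∃ x, b = a + x := ⟨b - a, by ring⟩
  rw [add_sub_cancel_left]
  rcases le_total 0 x with hx | hx
  -- For `x ≥ 0` the claim reduces to `(1 - x) e^x + x² / 2 ≤ 1`, an equality at `x = 0`.
  · have hanti : AntitoneOn (fun y : ℝ => (1 - y) * Real.exp y + y ^ 2 / 2) (Set.Ici 0) := by
      refine antitoneOn_of_hasDerivWithinAt_nonpos (f' := fun y => y * (1 - Real.exp y))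
        (convex_Ici 0) (by fun_prop) (fun y _ => ?_) fun y hy => ?_
      · have h := ((((hasDerivAt_id y).const_sub 1).mul (Real.hasDerivAt_exp y)).add
          (((hasDerivAt_id y).pow 2).div_const 2)).hasDerivWithinAt (s := interior (Set.Ici 0))
        refine h.congr_deriv ?_
        simp only [id]
        ring
      · rw [interior_Ici] at hy
        exact mul_nonpos_of_nonneg_of_nonpos (le_of_lt hy)
          (by linarith [Real.one_le_exp (le_of_lt (Set.mem_Ioi.1 hy))])
    have h1 : (1 - x) * Real.exp x + x ^ 2 / 2 ≤ 1 := by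
      simpa using hanti Set.self_mem_Ici hx hx
    have h2 : Real.exp (-a) = Real.exp (-(a + x)) * Real.exp x := by
      rw [← Real.exp_add]; ring_nf
    have h3 : Real.exp (-c) ≤ Real.exp (-(a + x)) := Real.exp_le_exp.2 (neg_le_neg hb)
    calc _ ≤ Real.exp (-a) - Real.exp (-a) * x + Real.exp (-(a + x)) / 2 * x ^ 2 := by gcongr
      _ = Real.exp (-(a + x)) * ((1 - x) * Real.exp x + x ^ 2 / 2) := by rw [h2]; ring
      _ ≤ Real.exp (-(a + x)) * 1 := mul_le_mul_of_nonneg_left h1 (Real.exp_pos _).le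
      _ = _ := mul_one _
  · have h1 := Real.quadratic_le_exp_of_nonneg (neg_nonneg.2 hx)
    have h2 : Real.exp (-(a + x)) = Real.exp (-a) * Real.exp (-x) := by
      rw [← Real.exp_add]; ring_nf
    have h3 : Real.exp (-c) ≤ Real.exp (-a) := Real.exp_le_exp.2 (neg_le_neg ha)
    calc _ ≤ Real.exp (-a) - Real.exp (-a) * x + Real.exp (-a) / 2 * x ^ 2 := by gcongr
      _ = Real.exp (-a) * (1 + -x + (-x) ^ 2 / 2) := by ring
      _ ≤ Real.exp (-a) * Real.exp (-x) := mul_le_mul_of_nonneg_left h1 (Real.exp_pos _).le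
      _ = _ := h2.symm

/-! ### The smallest positive eigenvalue -/

/-- Parseval's identity, phrased with `dotProduct` instead of the inner product of
`EuclideanSpace`. -/
theorem sum_dotProduct_eigenvectorBasis {κ : Type*} [Fintype κ] [DecidableEq κ]
    (e : OrthonormalBasis κ ℝ (EuclideanSpace ℝ κ)) (x y : κ → ℝ) :
    ∑ i, (x ⬝ᵥ (e i).ofLp) * ((e i).ofLp ⬝ᵥ y) = x ⬝ᵥ y := by
  have := e.sum_inner_mul_inner (WithLp.toLp 2 x) (WithLp.toLp 2 y)
  simpa [EuclideanSpace.inner_eq_star_dotProduct, dotProduct_comm] using this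

/-- If all positive eigenvalues of `Bᵀ B` are at least `s`, then
`s ⟨Bᵀ l, v⟩² ≤ ‖Bᵀ l‖² ‖B v‖²`, although `s ‖v‖² ≤ ‖B v‖²` may fail: `Bᵀ l` is orthogonal to
the kernel of `B`, so only the components of `v` along eigenvectors with positive eigenvalue
contribute. -/
theorem spectral_gap_bound {ι κ : Type*} [Fintype ι] [Fintype κ] [DecidableEq κ]
    (B : Matrix ι κ ℝ) {s : ℝ} (hs : 0 ≤ s)
    (h : ∀ x, 0 < x → Module.End.HasEigenvalue (Matrix.toLin' (B.transpose * B)) x → s ≤ x)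
    (l : ι → ℝ) (v : κ → ℝ) :
    s * (l ⬝ᵥ B.mulVec v) ^ 2 ≤
      (B.vecMul l ⬝ᵥ B.vecMul l) * (B.mulVec v ⬝ᵥ B.mulVec v) := by
  have hA : (B.transpose * B).IsHermitian := by
    simpa using Matrix.isHermitian_conjTranspose_mul_self B
  set A := B.transpose * B with hAdef
  have hAdot : ∀ x y : κ → ℝ, x ⬝ᵥ A.mulVec y = B.mulVec x ⬝ᵥ B.mulVec y := fun x y => by
    rw [hAdef, ← Matrix.mulVec_mulVec, Matrix.dotProduct_mulVec, Matrix.vecMul_transpose]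
  set e := hA.eigenvectorBasis with he
  set ev := hA.eigenvalues with hev
  have heig : ∀ i, A.mulVec (e i).ofLp = ev i • (e i).ofLp := hA.mulVec_eigenvectorBasis
  have hee : ∀ i, (e i).ofLp ⬝ᵥ (e i).ofLp = 1 := fun i => by
    have h2 : inner ℝ (e i) (e i) = (1 : ℝ) := by
      rw [real_inner_self_eq_norm_sq, e.orthonormal.1 i, one_pow]
    rwa [EuclideanSpace.inner_eq_star_dotProduct, star_trivial] at h2
  have hev_eq : ∀ i, B.mulVec (e i).ofLp ⬝ᵥ B.mulVec (e i).ofLp = ev i := fun i => by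
    rw [← hAdot, heig, dotProduct_smul, hee, smul_eq_mul, mul_one]
  have hev_nonneg : ∀ i, 0 ≤ ev i := fun i => by
    rw [← hev_eq i]
    exact Finset.sum_nonneg fun _ _ => mul_self_nonneg _
  have hs_le : ∀ i, ev i ≠ 0 → s ≤ ev i := fun i hi => by
    refine h _ (lt_of_le_of_ne (hev_nonneg i) hi.symm) ?_
    refine Module.End.hasEigenvalue_of_hasEigenvector (x := (e i).ofLp) ⟨?_, ?_⟩
    · rw [Module.End.mem_eigenspace_iff, Matrix.toLin'_apply, heig]
    · intro h0
      have := hee i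
      rw [h0] at this
      simp at this
  set w := B.vecMul l with hw
  have hwz : ∀ i, ev i = 0 → w ⬝ᵥ (e i).ofLp = 0 := fun i hi => by
    have h1 := hev_eq i
    rw [hi, dotProduct_self_eq_zero] at h1
    rw [hw, ← Matrix.dotProduct_mulVec, h1, dotProduct_zero]
  -- The coordinates of the projection of `v` onto the orthogonal complement of the kernel of `B`.
  set c : κ → ℝ := fun i => if ev i = 0 then 0 else (e i).ofLp ⬝ᵥ v with hc
  have hlv : l ⬝ᵥ B.mulVec v = ∑ i, (w ⬝ᵥ (e i).ofLp) * c i := by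
    rw [Matrix.dotProduct_mulVec, ← sum_dotProduct_eigenvectorBasis e]
    refine Finset.sum_congr rfl fun i _ => ?_
    by_cases hi : ev i = 0
    · simp only [hc, if_pos hi]
      rw [← hw, hwz i hi, zero_mul, zero_mul]
    · simp only [hc, if_neg hi]
      rfl
  have hww : w ⬝ᵥ w = ∑ i, (w ⬝ᵥ (e i).ofLp) ^ 2 := by
    rw [← sum_dotProduct_eigenvectorBasis e]
    exact Finset.sum_congr rfl fun i _ => by rw [dotProduct_comm (e i).ofLp w, sq]
  have hvv : B.mulVec v ⬝ᵥ B.mulVec v = ∑ i, ev i * ((e i).ofLp ⬝ᵥ v) ^ 2 := by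
    rw [← hAdot, ← sum_dotProduct_eigenvectorBasis e]
    refine Finset.sum_congr rfl fun i _ => ?_
    have : (e i).ofLp ⬝ᵥ A.mulVec v = ev i * ((e i).ofLp ⬝ᵥ v) := by
      rw [hAdot, dotProduct_comm, ← hAdot, heig, dotProduct_smul, smul_eq_mul,
        dotProduct_comm]
    rw [this, dotProduct_comm v]
    ring
  have hcs : s * ∑ i, c i ^ 2 ≤ B.mulVec v ⬝ᵥ B.mulVec v := by
    rw [hvv, Finset.mul_sum]
    refine Finset.sum_le_sum fun i _ => ?_
    by_cases hi : ev i = 0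
    · simp [hc, hi]
    · simp only [hc, if_neg hi]
      exact mul_le_mul_of_nonneg_right (hs_le i hi) (sq_nonneg _)
  rw [hlv]
  calc s * (∑ i, (w ⬝ᵥ (e i).ofLp) * c i) ^ 2
      ≤ s * ((∑ i, (w ⬝ᵥ (e i).ofLp) ^ 2) * ∑ i, c i ^ 2) :=
        mul_le_mul_of_nonneg_left (Finset.sum_mul_sq_le_sq_mul_sq _ _ _) hs
    _ = (w ⬝ᵥ w) * (s * ∑ i, c i ^ 2) := by rw [hww]; ring
    _ ≤ _ := mul_le_mul_of_nonneg_left hcs (by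
        rw [hww]; exact Finset.sum_nonneg fun _ _ => sq_nonneg _)

theorem posEigenvalues_finite (M : Matrix (Fin m) (Fin N) ℝ) (Z : Finset (Fin m)) :
    (posEigenvalues M Z).Finite :=
  (Module.End.finite_hasEigenvalue
    (Matrix.toLin' ((restrictRows M Z).transpose * restrictRows M Z))).subset fun _ hx => hx.2

theorem lambdaMinSq_pos (M : Matrix (Fin m) (Fin N) ℝ) (Z : Finset (Fin m)) :
    0 < lambdaMinSq M Z := by
  unfold lambdaMinSq
  split_ifs with h
  · exact (h.csInf_mem (posEigenvalues_finite M Z)).1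
  · exact one_pos

theorem lambdaMinSq_le_of_hasEigenvalue (M : Matrix (Fin m) (Fin N) ℝ) (Z : Finset (Fin m))
    {x : ℝ} (hx : x ∈ posEigenvalues M Z) : lambdaMinSq M Z ≤ x := by
  unfold lambdaMinSq
  rw [if_pos ⟨x, hx⟩]
  exact csInf_le ⟨0, fun y hy => hy.1.le⟩ hx

/-- The eigenvalues of `M_Fᵀ M_F` are at most the squared Frobenius norm of `M_F`; positivity of `m`
and `N` covers the convention `λ_min² = 1`. -/
theorem lambdaMinSq_le (hm : 0 < m) (hN : 0 < N) (M : Matrix (Fin m) (Fin N) ℝ)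
    (hM : ∀ i k, |M i k| ≤ 1) (Z : Finset (Fin m)) :
    lambdaMinSq M Z ≤ m * N := by
  by_cases h : (posEigenvalues M Z).Nonempty
  · obtain ⟨x, hx⟩ := h
    refine (lambdaMinSq_le_of_hasEigenvalue M Z hx).trans ?_
    obtain ⟨v, hv⟩ := hx.2.exists_hasEigenvector
    set B := restrictRows M Z with hB
    have hv1 : (B.transpose * B).mulVec v = x • v := by
      simpa [Matrix.toLin'_apply] using hv.apply_eq_smul
    have hpos : 0 < v ⬝ᵥ v := lt_of_le_of_ne
      (Finset.sum_nonneg fun _ _ => mul_self_nonneg _)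
      fun h0 => hv.2 (dotProduct_self_eq_zero.1 h0.symm)
    have hxv : x * (v ⬝ᵥ v) = ∑ i, (B.mulVec v i) ^ 2 := by
      rw [← smul_eq_mul, ← dotProduct_smul, ← hv1, ← Matrix.mulVec_mulVec,
        Matrix.dotProduct_mulVec, Matrix.vecMul_transpose]
      exact Finset.sum_congr rfl fun i _ => (sq _).symm
    have hrow : ∀ i, (B.mulVec v i) ^ 2 ≤ N * (v ⬝ᵥ v) := fun i => by
      calc (B.mulVec v i) ^ 2 ≤ (∑ k, B i k ^ 2) * ∑ k, v k ^ 2 :=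
            Finset.sum_mul_sq_le_sq_mul_sq Finset.univ (B i) v
        _ ≤ (∑ _k : Fin N, (1 : ℝ)) * ∑ k, v k ^ 2 := by
            refine mul_le_mul_of_nonneg_right (Finset.sum_le_sum fun k _ => ?_)
              (Finset.sum_nonneg fun _ _ => sq_nonneg _)
            exact (sq_le_one_iff_abs_le_one _).2 (hM _ _)
        _ = N * (v ⬝ᵥ v) := by simp [dotProduct, sq]
    have hcard : (Fintype.card {i : Fin m // i ∈ Zᶜ} : ℝ) ≤ m := by
      have := Fintype.card_subtype_le (fun i : Fin m => i ∈ Zᶜ)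
      rw [Fintype.card_fin] at this
      exact_mod_cast this
    have : x * (v ⬝ᵥ v) ≤ m * N * (v ⬝ᵥ v) := by
      rw [hxv]
      calc _ ≤ ∑ _i : {i : Fin m // i ∈ Zᶜ}, (N : ℝ) * (v ⬝ᵥ v) :=
            Finset.sum_le_sum fun i _ => hrow i
        _ = Fintype.card {i : Fin m // i ∈ Zᶜ} * (N * (v ⬝ᵥ v)) := by
            rw [Finset.sum_const, nsmul_eq_mul, Finset.card_univ]
        _ ≤ m * (N * (v ⬝ᵥ v)) := mul_le_mul_of_nonneg_right hcard (by positivity)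
        _ = _ := by ring
    exact le_of_mul_le_mul_right this hpos
  · unfold lambdaMinSq
    rw [if_neg h]
    exact_mod_cast Nat.mul_pos hm hN

/-! ### Elementary properties of the exponential loss -/

theorem exampleLoss_pos (M : Matrix (Fin m) (Fin N) ℝ) (lam : Fin N → ℝ) (i : Fin m) :
    0 < exampleLoss M lam i := Real.exp_pos _

theorem sum_exampleLoss_pos (hm : 0 < m) (M : Matrix (Fin m) (Fin N) ℝ) (lam : Fin N → ℝ) :
    0 < ∑ i, exampleLoss M lam i :=
  Finset.sum_pos (fun i _ => exampleLoss_pos M lam i) ⟨⟨0, hm⟩, Finset.mem_univ _⟩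

theorem exampleLoss_add_single (M : Matrix (Fin m) (Fin N) ℝ) (lam : Fin N → ℝ) (k : Fin N)
    (a : ℝ) (i : Fin m) :
    exampleLoss M (lam + Pi.single k a) i = exampleLoss M lam i * Real.exp (-(a * M i k)) := by
  rw [exampleLoss, exampleLoss, ← Real.exp_add, Matrix.mulVec_add, Pi.add_apply,
    Matrix.mulVec_single]
  congr 1
  simp
  ring

/-! ### A lower bound on the gradient of the loss -/

/-- Hölder's inequality between the `ℓ^∞` norm of `Mᵀ w` and the `ℓ¹` norm of `η`. -/
theorem sum_mul_mulVec_le {ι : Type*} (s : Finset ι) {κ : Type*} [Fintype κ] (M : Matrix ι κ ℝ)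
    (w : ι → ℝ) {G : ℝ} (hG : ∀ k, |∑ i ∈ s, w i * M i k| ≤ G) (η : κ → ℝ) :
    ∑ i ∈ s, w i * M.mulVec η i ≤ G * ∑ k, |η k| := by
  have h : ∑ i ∈ s, w i * M.mulVec η i = ∑ k, η k * ∑ i ∈ s, w i * M i k := by
    simp only [Matrix.mulVec, dotProduct, Finset.mul_sum]
    rw [Finset.sum_comm]
    exact Finset.sum_congr rfl fun _ _ => Finset.sum_congr rfl fun _ _ => by ring
  rw [h, Finset.mul_sum]
  refine Finset.sum_le_sum fun k _ => ?_
  calc _ ≤ |η k * ∑ i ∈ s, w i * M i k| := le_abs_self _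
    _ = |∑ i ∈ s, w i * M i k| * |η k| := by rw [abs_mul, mul_comm]
    _ ≤ _ := mul_le_mul_of_nonneg_right (hG k) (abs_nonneg _)

/-- The weight of the zero-loss set is controlled by the largest correlation, because some
combination of hypotheses has margin at least `γ` there and margin `0` elsewhere. -/
theorem IsDecomposition.margin_mul_sum_le {M : Matrix (Fin m) (Fin N) ℝ} {Z : Finset (Fin m)}
    {γ μmax : ℝ} (h : IsDecomposition M Z γ μmax) {w : Fin m → ℝ} (hw : ∀ i, 0 ≤ w i)
    {G : ℝ} (hG0 : 0 ≤ G) (hG : ∀ k, |∑ i, w i * M i k| ≤ G) :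
    γ * ∑ i ∈ Z, w i ≤ G := by
  rcases Z.eq_empty_or_nonempty with rfl | hZ
  · simpa using hG0
  · obtain ⟨η, hη1, hηZ, hηF⟩ := h.margin hZ
    have h1 := sum_mul_mulVec_le Finset.univ M w hG η
    rw [hη1, mul_one, ← Finset.sum_add_sum_compl Z,
      Finset.sum_eq_zero (s := Zᶜ) fun i hi => by rw [hηF i hi, mul_zero], add_zero] at h1
    refine le_trans ?_ h1
    rw [Finset.mul_sum]
    refine Finset.sum_le_sum fun i hi => ?_
    rw [mul_comm]
    exact mul_le_mul_of_nonneg_left (hηZ i hi) (hw i)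

/-- Polyak-Łojasiewicz inequality for the loss on the finite-margin set: its suboptimality is
bounded by the squared sup-norm of its gradient. -/
theorem IsDecomposition.suboptimality_le {M : Matrix (Fin m) (Fin N) ℝ} {Z : Finset (Fin m)}
    {γ μmax : ℝ} (h : IsDecomposition M Z γ μmax) {ηs : Fin N → ℝ}
    (hs : ∀ η, ∑ i ∈ Zᶜ, exampleLoss M ηs i ≤ ∑ i ∈ Zᶜ, exampleLoss M η i)
    {lam : Fin N → ℝ} (hlam : ∑ i ∈ Zᶜ, exampleLoss M lam i ≤ m)
    {G : ℝ} (hG : ∀ k, |∑ i ∈ Zᶜ, exampleLoss M lam i * M i k| ≤ G) :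
    2 * (Real.exp (-μmax) * lambdaMinSq M Z) *
      (∑ i ∈ Zᶜ, exampleLoss M lam i - ∑ i ∈ Zᶜ, exampleLoss M ηs i) ≤ N * G ^ 2 := by
  set B := restrictRows M Z with hB
  set l : {i : Fin m // i ∈ Zᶜ} → ℝ := fun i => exampleLoss M lam i with hl
  set x := B.mulVec (ηs - lam) with hx
  set s := lambdaMinSq M Z with hsdef
  set e := Real.exp (-μmax) with he
  have hs0 : 0 < s := lambdaMinSq_pos M Z
  have he0 : 0 < e := Real.exp_pos _
  have hxi : ∀ i, x i = M.mulVec ηs i - M.mulVec lam i := fun i => by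
    rw [hx, Matrix.mulVec_sub]; rfl
  have hspec : s * (l ⬝ᵥ x) ^ 2 ≤ (B.vecMul l ⬝ᵥ B.vecMul l) * (x ⬝ᵥ x) :=
    spectral_gap_bound B hs0.le
      (fun y hy hy2 => lambdaMinSq_le_of_hasEigenvalue M Z ⟨hy, hy2⟩) l (ηs - lam)
  have hW : B.vecMul l ⬝ᵥ B.vecMul l ≤ N * G ^ 2 := by
    calc _ ≤ ∑ _k : Fin N, G ^ 2 := by
          refine Finset.sum_le_sum fun k _ => ?_
          rw [← sq]
          refine sq_le_sq' (abs_le.1 ?_).1 (abs_le.1 ?_).2 <;>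
          · have := hG k
            rwa [← Finset.sum_coe_sort] at this
      _ = _ := by simp
  have hconv : ∑ i ∈ Zᶜ, exampleLoss M lam i - l ⬝ᵥ x + e / 2 * (x ⬝ᵥ x) ≤
      ∑ i ∈ Zᶜ, exampleLoss M ηs i := by
    rw [← Finset.sum_coe_sort, ← Finset.sum_coe_sort Zᶜ, dotProduct, dotProduct,
      ← Finset.sum_sub_distrib, Finset.mul_sum, ← Finset.sum_add_distrib]
    refine Finset.sum_le_sum fun i _ => ?_
    have := exp_neg_strongConvex (h.bounded lam hlam i i.2).2
      (h.bounded ηs ((hs lam).trans hlam) i i.2).2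
    rw [hxi, ← sq]
    exact this
  refine le_trans ?_ hW
  set p := l ⬝ᵥ x
  set X := x ⬝ᵥ x with hX
  set W := B.vecMul l ⬝ᵥ B.vecMul l
  have hX0 : 0 ≤ X := Finset.sum_nonneg fun _ _ => mul_self_nonneg _
  have hW0 : 0 ≤ W := Finset.sum_nonneg fun _ _ => mul_self_nonneg _
  have hD : ∑ i ∈ Zᶜ, exampleLoss M lam i - ∑ i ∈ Zᶜ, exampleLoss M ηs i ≤ p - e / 2 * X := by
    linarith
  -- The maximum of `p - e X / 2` subject to `s p² ≤ W X`, by `s (p - e X)² ≥ 0`, divided by `X`.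
  have h1 : 2 * (e * s) * (p - e / 2 * X) ≤ W := by
    rcases hX0.eq_or_lt with h0 | h0
    · have hp : p = 0 := by
        rw [← h0, mul_zero] at hspec
        have : p ^ 2 ≤ 0 := by
          by_contra! hc
          exact absurd hspec (not_le.2 (mul_pos hs0 hc))
        exact pow_eq_zero_iff (two_ne_zero) |>.1 (le_antisymm this (sq_nonneg _))
      rw [← h0, hp]
      simpa using hW0
    · refine le_of_mul_le_mul_right (le_trans ?_ hspec) h0
      have := mul_nonneg hs0.le (sq_nonneg (p - e * X))
      linarith
  exact (mul_le_mul_of_nonneg_left hD (by positivity)).trans h1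

/-- The suboptimality of the total loss, compared with its minimum on the finite-margin set, is
bounded by a multiple of any bound `G` on the sup-norm of the gradient. -/
theorem IsDecomposition.gradient_bound (hm : 0 < m) (hN : 0 < N)
    {M : Matrix (Fin m) (Fin N) ℝ} (hM : ∀ i k, |M i k| ≤ 1) {Z : Finset (Fin m)}
    {γ μmax : ℝ} (h : IsDecomposition M Z γ μmax) {ηs : Fin N → ℝ}
    (hs : ∀ η, ∑ i ∈ Zᶜ, exampleLoss M ηs i ≤ ∑ i ∈ Zᶜ, exampleLoss M η i)
    {lam : Fin N → ℝ} (hlam : ∑ i, exampleLoss M lam i ≤ m)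
    {G : ℝ} (hG0 : 0 ≤ G) (hG : ∀ k, |∑ i, exampleLoss M lam i * M i k| ≤ G) :
    γ ^ 2 * (Real.exp (-μmax) * lambdaMinSq M Z) *
      (∑ i, exampleLoss M lam i - ∑ i ∈ Zᶜ, exampleLoss M ηs i) ^ 2 ≤ 6 * N * m * G ^ 2 := by
  set κ := Real.exp (-μmax) * lambdaMinSq M Z with hκ
  have hκ0 : 0 < κ := mul_pos (Real.exp_pos _) (lambdaMinSq_pos M Z)
  have hκle : κ ≤ N * m := by
    calc κ ≤ 1 * (m * N) := mul_le_mul (Real.exp_le_one_iff.2 (neg_nonpos.2 h.mu_nonneg))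
          (lambdaMinSq_le hm hN M hM Z) (lambdaMinSq_pos M Z).le zero_le_one
      _ = N * m := by ring
  set z := ∑ i ∈ Z, exampleLoss M lam i with hz
  set f := ∑ i ∈ Zᶜ, exampleLoss M lam i with hf
  set K := ∑ i ∈ Zᶜ, exampleLoss M ηs i with hK
  have hsum : ∑ i, exampleLoss M lam i = z + f := (Finset.sum_add_sum_compl Z _).symm
  have hz0 : 0 ≤ z := Finset.sum_nonneg fun i _ => (exampleLoss_pos M lam i).le
  have hK0 : 0 ≤ K := Finset.sum_nonneg fun i _ => (exampleLoss_pos M ηs i).le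
  have hKf : K ≤ f := hs lam
  have hfm : f ≤ m := by linarith
  have hγz : γ * z ≤ G := h.margin_mul_sum_le (fun i => (exampleLoss_pos M lam i).le) hG0 hG
  have hGF : ∀ k, |∑ i ∈ Zᶜ, exampleLoss M lam i * M i k| ≤ G + z := fun k => by
    have h1 : ∑ i ∈ Zᶜ, exampleLoss M lam i * M i k =
        ∑ i, exampleLoss M lam i * M i k - ∑ i ∈ Z, exampleLoss M lam i * M i k := by
      rw [← Finset.sum_add_sum_compl Z]; ring
    rw [h1]
    refine (abs_sub _ _).trans (add_le_add (hG k) ((Finset.abs_sum_le_sum_abs _ _).trans ?_))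
    refine Finset.sum_le_sum fun i _ => ?_
    rw [abs_mul, abs_of_pos (exampleLoss_pos M lam i)]
    exact mul_le_of_le_one_right (exampleLoss_pos M lam i).le (hM i k)
  have hsub : 2 * κ * (f - K) ≤ N * (G + z) ^ 2 := h.suboptimality_le hs hfm hGF
  have hγ0 := h.gamma_pos
  have hGz : γ * (G + z) ≤ 2 * G := by
    have := mul_le_of_le_one_left hG0 h.gamma_le_one
    linarith
  have hsq : (γ * (G + z)) ^ 2 ≤ (2 * G) ^ 2 := pow_le_pow_left₀ (by positivity) hGz 2
  have hF : γ ^ 2 * κ * (f - K) ≤ 2 * N * G ^ 2 := by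
    have h1 := mul_le_mul_of_nonneg_left hsub (sq_nonneg γ)
    have h2 := mul_le_mul_of_nonneg_left hsq (Nat.cast_nonneg (α := ℝ) N)
    linarith
  -- Trade a factor `f - K` for `m`, to match the quadratic bound available on `Z`.
  have hF2 : γ ^ 2 * κ * (f - K) ^ 2 ≤ 2 * N * m * G ^ 2 := by
    calc _ = γ ^ 2 * κ * (f - K) * (f - K) := by ring
      _ ≤ 2 * N * G ^ 2 * m :=
        mul_le_mul hF (by linarith) (sub_nonneg.2 hKf) (by positivity)
      _ = _ := by ring
  have hZ2 : γ ^ 2 * κ * z ^ 2 ≤ N * m * G ^ 2 := by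
    calc _ = κ * (γ * z) ^ 2 := by ring
      _ ≤ N * m * G ^ 2 :=
        mul_le_mul hκle (pow_le_pow_left₀ (by positivity) hγz 2) (sq_nonneg _) (by positivity)
  rw [hsum]
  have h2 : (z + f - K) ^ 2 ≤ 2 * (f - K) ^ 2 + 2 * z ^ 2 := by
    linarith [sq_nonneg (z - (f - K))]
  have := mul_le_mul_of_nonneg_left h2 (by positivity : 0 ≤ γ ^ 2 * κ)
  linarith

/-! ### The dynamics of AdaBoost -/

/-- A step of AdaBoost along a hypothesis of correlation `r` multiplies the loss by at most
`1 - r² / 2`. -/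
theorem sum_exampleLoss_add_single_le (hm : 0 < m) {M : Matrix (Fin m) (Fin N) ℝ}
    (hM : ∀ i k, |M i k| ≤ 1) (lam : Fin N → ℝ) {D : Fin m → ℝ}
    (hD : ∀ i, D i = exampleLoss M lam i / ∑ k, exampleLoss M lam k) (j : Fin N)
    (hr : |correlation M D j| < 1) :
    ∑ i, exampleLoss M (lam + Pi.single j (stepSize (correlation M D j))) i ≤
      (∑ i, exampleLoss M lam i) * (1 - correlation M D j ^ 2 / 2) := by
  have hS := sum_exampleLoss_pos hm M lam
  have hl : ∀ i, exampleLoss M lam i = (∑ k, exampleLoss M lam k) * D i := fun i => by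
    rw [hD, mul_div_cancel₀ _ hS.ne']
  have hD1 : ∑ i, D i = 1 := by
    simp only [hD]
    rw [← Finset.sum_div, div_self hS.ne']
  have hDpos : ∀ i, 0 ≤ D i := fun i => by
    rw [hD]
    exact (div_pos (exampleLoss_pos _ _ _) hS).le
  have hrsum : ∑ i, D i * M i j = correlation M D j := rfl
  generalize correlation M D j = r at hr hrsum ⊢
  generalize ∑ k, exampleLoss M lam k = S at hS hl ⊢
  have hsplit : ∑ i, exampleLoss M (lam + Pi.single j (stepSize r)) i =
      S * ∑ i, D i * Real.exp (-(stepSize r * M i j)) := by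
    rw [Finset.mul_sum]
    exact Finset.sum_congr rfl fun i _ => by rw [exampleLoss_add_single, hl, mul_assoc]
  rw [hsplit]
  refine mul_le_mul_of_nonneg_left ?_ hS.le
  have hb := stepSize_bound hr
  generalize stepSize r = a at hb ⊢
  calc ∑ i, D i * Real.exp (-(a * M i j))
      ≤ ∑ i, D i * ((1 + M i j) / 2 * Real.exp (-a) + (1 - M i j) / 2 * Real.exp a) :=
        Finset.sum_le_sum fun i _ =>
          mul_le_mul_of_nonneg_left (exp_neg_mul_le a (hM _ _)) (hDpos i)
    _ = ((∑ i, D i) + ∑ i, D i * M i j) / 2 * Real.exp (-a) +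
          ((∑ i, D i) - ∑ i, D i * M i j) / 2 * Real.exp a := by
        rw [← Finset.sum_add_distrib, ← Finset.sum_sub_distrib, Finset.sum_div, Finset.sum_div,
          Finset.sum_mul, Finset.sum_mul, ← Finset.sum_add_distrib]
        exact Finset.sum_congr rfl fun i _ => by ring
    _ ≤ 1 - r ^ 2 / 2 := by
        rwa [hD1, hrsum]

section Dynamics

variable {M : Matrix (Fin m) (Fin N) ℝ}

theorem Run.abs_r_le_one (hm : 0 < m) (hM : ∀ i k, |M i k| ≤ 1) (R : Run M) {t : ℕ}
    (hD : ∀ i, R.D t i = exampleLoss M (R.lam t) i / ∑ k, exampleLoss M (R.lam t) k) :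
    |R.r t| ≤ 1 := by
  have hS := sum_exampleLoss_pos hm M (R.lam t)
  calc |R.r t| ≤ ∑ i, |R.D t i * M i (R.j t)| :=
        Finset.abs_sum_le_sum_abs (fun i => R.D t i * M i (R.j t)) Finset.univ
    _ ≤ ∑ i, exampleLoss M (R.lam t) i / ∑ k, exampleLoss M (R.lam t) k := by
        refine Finset.sum_le_sum fun i _ => ?_
        have h0 := (div_pos (exampleLoss_pos M (R.lam t) i) hS).le
        rw [hD, abs_mul, abs_of_nonneg h0]
        exact mul_le_of_le_one_right h0 (hM _ _)
    _ = 1 := by rw [← Finset.sum_div, div_self hS.ne']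

/-- The distribution `D` is proportional to the example losses, up to the first infinite step. -/
theorem Run.D_eq (hm : 0 < m) (hM : ∀ i k, |M i k| ≤ 1) (R : Run M) {t : ℕ}
    (ht : ∀ s < t, |R.r s| ≠ 1) (i : Fin m) :
    R.D t i = exampleLoss M (R.lam t) i / ∑ k, exampleLoss M (R.lam t) k := by
  induction t generalizing i with
  | zero => simp [R.D_zero, R.lam_zero, exampleLoss]
  | succ t ih =>
    have hD := ih fun s hs => ht s (Nat.lt_succ_of_lt hs)
    have hr : |correlation M (R.D t) (R.j t)| < 1 :=
      lt_of_le_of_ne (R.abs_r_le_one hm hM hD) (ht t (Nat.lt_succ_self t))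
    have hS := sum_exampleLoss_pos hm M (R.lam t)
    rw [R.D_succ t hr, R.lam_succ t hr]
    simp only [exampleLoss_add_single]
    set a := stepSize (correlation M (R.D t) (R.j t))
    simp only [hD, div_mul_eq_mul_div]
    rw [← Finset.sum_div, div_div_div_cancel_right₀ hS.ne']

theorem Run.sum_exampleLoss_succ_le (hm : 0 < m) (hM : ∀ i k, |M i k| ≤ 1) (R : Run M) {t : ℕ}
    (ht : ∀ s < t + 1, |R.r s| ≠ 1) :
    ∑ i, exampleLoss M (R.lam (t + 1)) i ≤
      (∑ i, exampleLoss M (R.lam t) i) * (1 - R.r t ^ 2 / 2) := by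
  have hD := R.D_eq hm hM fun s hs => ht s (Nat.lt_succ_of_lt hs)
  have hr : |R.r t| < 1 := lt_of_le_of_ne (R.abs_r_le_one hm hM hD) (ht t (Nat.lt_succ_self t))
  rw [R.lam_succ t hr]
  exact sum_exampleLoss_add_single_le hm hM _ hD _ hr

theorem Run.abs_sum_exampleLoss_mul_le (hm : 0 < m) (hM : ∀ i k, |M i k| ≤ 1) (R : Run M) {t : ℕ}
    (ht : ∀ s < t, |R.r s| ≠ 1) (k : Fin N) :
    |∑ i, exampleLoss M (R.lam t) i * M i k| ≤
      (∑ i, exampleLoss M (R.lam t) i) * |R.r t| := by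
  have hS := sum_exampleLoss_pos hm M (R.lam t)
  have hl : ∑ i, exampleLoss M (R.lam t) i * M i k =
      (∑ i, exampleLoss M (R.lam t) i) * correlation M (R.D t) k := by
    rw [correlation, Finset.mul_sum]
    refine Finset.sum_congr rfl fun i _ => ?_
    rw [R.D_eq hm hM ht, ← mul_assoc, mul_div_cancel₀ _ hS.ne']
  rw [hl, abs_mul, abs_of_pos hS]
  exact mul_le_mul_of_nonneg_left (R.greedy t k) hS.le

theorem Run.sum_exampleLoss_le (hm : 0 < m) (hM : ∀ i k, |M i k| ≤ 1) (R : Run M) {t : ℕ}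
    (ht : ∀ s < t, |R.r s| ≠ 1) : ∑ i, exampleLoss M (R.lam t) i ≤ m := by
  induction t with
  | zero => simp [R.lam_zero, exampleLoss]
  | succ t ih =>
    refine (R.sum_exampleLoss_succ_le hm hM ht).trans
      ((mul_le_of_le_one_right (sum_exampleLoss_pos hm M _).le ?_).trans
        (ih fun s hs => ht s (Nat.lt_succ_of_lt hs)))
    linarith [sq_nonneg (R.r t)]

end Dynamics

/-! ### The rate of convergence -/

/-- A sequence with `d_{t+1} ≤ d_t - c d_t²` decays at least like `1 / (1 + c t)`. -/
theorem mul_one_add_mul_le_one {d : ℕ → ℝ} {c : ℝ} (hc : 0 < c) (hd0 : d 0 ≤ 1)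
    (hd : ∀ t, 0 ≤ d t) {n : ℕ} (hrec : ∀ t < n, d (t + 1) ≤ d t - c * d t ^ 2) :
    d n * (1 + c * n) ≤ 1 := by
  induction n with
  | zero => simpa using hd0
  | succ n ih =>
    have h1 := ih fun t ht => hrec t (Nat.lt_succ_of_lt ht)
    have h2 := hrec n (Nat.lt_succ_self n)
    have hpos : 0 < 1 + c * d n := by have := mul_nonneg hc.le (hd n); linarith
    have h3 : d (n + 1) * (1 + c * d n) ≤ d n := by
      calc d (n + 1) * (1 + c * d n) ≤ (d n - c * d n ^ 2) * (1 + c * d n) :=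
            mul_le_mul_of_nonneg_right h2 hpos.le
        _ = d n - c ^ 2 * d n ^ 2 * d n := by ring
        _ ≤ d n := by
            have := mul_nonneg (mul_nonneg (sq_nonneg c) (sq_nonneg (d n))) (hd n)
            linarith
    have hp : 0 ≤ 1 + c * (n + 1) := by positivity
    refine le_of_mul_le_mul_right ?_ hpos
    push_cast
    calc d (n + 1) * (1 + c * (n + 1)) * (1 + c * d n)
        = d (n + 1) * (1 + c * d n) * (1 + c * (n + 1)) := by ring
      _ ≤ d n * (1 + c * (n + 1)) := mul_le_mul_of_nonneg_right h3 hp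
      _ = d n * (1 + c * n) + c * d n := by ring
      _ ≤ 1 * (1 + c * d n) := by linarith

theorem IsDecomposition.reachesOptimumWithin (hm : 0 < m) (hN : 0 < N)
    {M : Matrix (Fin m) (Fin N) ℝ} (hM : ∀ i k, |M i k| ≤ 1) {Z : Finset (Fin m)}
    {γ μmax : ℝ} (h : IsDecomposition M Z γ μmax) :
    ReachesOptimumWithin M
      (32 * (m : ℝ) ^ 3 * (N : ℝ) * Real.exp μmax / (γ ^ 2 * lambdaMinSq M Z)) := by
  intro ε hε R
  obtain ⟨ηs, hs⟩ := h.optimal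
  have hm1 : (1 : ℝ) ≤ m := by exact_mod_cast hm
  have hN1 : (1 : ℝ) ≤ N := by exact_mod_cast hN
  have hm0 : (0 : ℝ) < m := by linarith
  have hN0 : (0 : ℝ) < N := by linarith
  have hγ := h.gamma_pos
  have hlm := lambdaMinSq_pos M Z
  set K := ∑ i ∈ Zᶜ, exampleLoss M ηs i with hK
  have hK0 : 0 ≤ K := Finset.sum_nonneg fun i _ => (exampleLoss_pos M ηs i).le
  have hKS : ∀ lam, K ≤ ∑ i, exampleLoss M lam i := fun lam =>
    (hs lam).trans (Finset.sum_le_univ_sum_of_nonneg fun i => (exampleLoss_pos M lam i).le)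
  have hinf : K / m ≤ ⨅ lam : Fin N → ℝ, expLoss M lam := le_ciInf fun lam => by
    rw [expLoss, one_div, inv_mul_eq_div]
    exact div_le_div_of_nonneg_right (hKS lam) hm0.le
  set κ := Real.exp (-μmax) * lambdaMinSq M Z with hκ
  have hκ0 : 0 < κ := mul_pos (Real.exp_pos _) hlm
  have hκle : κ ≤ N * m := by
    calc κ ≤ 1 * (m * N) := mul_le_mul (Real.exp_le_one_iff.2 (neg_nonpos.2 h.mu_nonneg))
          (lambdaMinSq_le hm hN M hM Z) (lambdaMinSq_pos M Z).le zero_le_one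
      _ = N * m := by ring
  set c := γ ^ 2 * κ / (12 * N * m) with hc
  have hc0 : 0 < c := by positivity
  have hc1 : c ≤ 1 := by
    rw [hc, div_le_one (by positivity)]
    have : γ ^ 2 * κ ≤ 1 * (N * m) :=
      mul_le_mul (pow_le_one₀ hγ.le h.gamma_le_one) hκle hκ0.le zero_le_one
    have := mul_pos hN0 hm0
    linarith
  have hCc : 1 / (c * ε) ≤
      32 * (m : ℝ) ^ 3 * (N : ℝ) * Real.exp μmax / (γ ^ 2 * lambdaMinSq M Z) / ε := by
    have h1 : 1 / (c * ε) =
        12 * m * N * Real.exp μmax / (γ ^ 2 * lambdaMinSq M Z) / ε := by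
      rw [hc, hκ, Real.exp_neg]
      field_simp
    rw [h1]
    gcongr ?_ * _ * _ / _ / _
    have h3 : (m : ℝ) ≤ m ^ 3 := le_self_pow₀ hm1 (by norm_num)
    linarith
  -- Rounding down is harmless: `1 + c n ≥ c (n + 1) > 1 / ε`, because `c ≤ 1`.
  set n := ⌊1 / (c * ε)⌋₊ with hn
  refine ⟨n, (Nat.floor_le (by positivity)).trans hCc, ?_⟩
  rw [Run.lossAfter]
  split_ifs with hfinite
  · exact add_nonneg ((div_nonneg hK0 hm0.le).trans hinf) hε.le
  · push Not at hfinite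
    set d : ℕ → ℝ := fun t => (∑ i, exampleLoss M (R.lam t) i - K) / m with hd
    have hdn : d n * (1 + c * n) ≤ 1 := by
      refine mul_one_add_mul_le_one hc0 ?_ (fun t => div_nonneg (sub_nonneg.2 (hKS _)) hm0.le)
        fun t ht => ?_
      · rw [div_le_one hm0]
        have := R.sum_exampleLoss_le hm hM (t := 0) (by simp)
        linarith
      · have ht' : ∀ s < t + 1, |R.r s| ≠ 1 := fun s hst => hfinite s (by omega)
        have ht'' : ∀ s < t, |R.r s| ≠ 1 := fun s hst => hfinite s (by omega)
        have hS := sum_exampleLoss_pos hm M (R.lam t)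
        have hSm := R.sum_exampleLoss_le hm hM ht''
        have hstep := R.sum_exampleLoss_succ_le hm hM ht'
        have hgrad := h.gradient_bound hm hN hM hs hSm (mul_nonneg hS.le (abs_nonneg (R.r t)))
          (R.abs_sum_exampleLoss_mul_le hm hM ht'')
        set S := ∑ i, exampleLoss M (R.lam t) i with hSdef
        rw [mul_pow, sq_abs] at hgrad
        have hSr : (S * R.r t) ^ 2 ≤ m * (S * R.r t ^ 2) := by
          calc _ = S * (S * R.r t ^ 2) := by ring
            _ ≤ _ := mul_le_mul_of_nonneg_right hSm (by positivity)
        have hkey : c * (S - K) ^ 2 ≤ m * (S * R.r t ^ 2 / 2) := by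
          rw [hc, div_mul_eq_mul_div, div_le_iff₀ (by positivity)]
          calc _ ≤ 6 * N * m * (S ^ 2 * R.r t ^ 2) := hgrad
            _ = 6 * N * m * (S * R.r t) ^ 2 := by ring
            _ ≤ 6 * N * m * (m * (S * R.r t ^ 2)) :=
              mul_le_mul_of_nonneg_left hSr (by positivity)
            _ = _ := by ring
        have hkey2 : c * d t ^ 2 ≤ S * R.r t ^ 2 / 2 / m := by
          rw [hd, div_pow, ← mul_div_assoc, div_le_div_iff₀ (by positivity) hm0]
          calc _ ≤ m * (S * R.r t ^ 2 / 2) * m := mul_le_mul_of_nonneg_right hkey hm0.le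
            _ = _ := by ring
        calc d (t + 1) ≤ (S * (1 - R.r t ^ 2 / 2) - K) / m := by
              simp only [hd]; gcongr
          _ = d t - S * R.r t ^ 2 / 2 / m := by simp only [hd]; ring
          _ ≤ _ := by linarith
    have hlt : 1 ≤ ε * (1 + c * n) := by
      have h1 : 1 / (c * ε) < n + 1 := Nat.lt_floor_add_one _
      rw [div_lt_iff₀ (by positivity)] at h1
      calc (1 : ℝ) ≤ (n + 1) * (c * ε) := h1.le
        _ = ε * (c + c * n) := by ring
        _ ≤ _ := by gcongr
    have hdε : d n ≤ ε := le_of_mul_le_mul_right (hdn.trans hlt) (by positivity)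
    have : expLoss M (R.lam n) = K / m + d n := by
      simp only [hd, expLoss]; ring
    linarith

/-! ### Existence of a decomposition -/

/-- If the range of `B` meets the nonnegative orthant only in `0`, then lower bounds on the
coordinates of vectors in this range bound them on both sides. -/
theorem exists_bound_abs_mulVec {ι κ : Type*} [Fintype ι] [Fintype κ]
    (B : Matrix ι κ ℝ) (hB : ∀ η, (∀ i, 0 ≤ B.mulVec η i) → B.mulVec η = 0) (c : ℝ) :
    ∃ C : ℝ, ∀ η, (∀ i, -c ≤ B.mulVec η i) → ∀ i, |B.mulVec η i| ≤ C := by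
  classical
  set V := LinearMap.range B.mulVecLin with hV
  -- The total negative part; it is positive, hence bounded below, on the unit sphere of the range.
  set φ : (ι → ℝ) → ℝ := fun u => ∑ i, max 0 (-u i) with hφ
  have hφc : Continuous φ := by fun_prop
  set K : Set (ι → ℝ) := V ∩ Metric.sphere 0 1 with hK
  have hKc : IsCompact K :=
    (isCompact_sphere (0 : ι → ℝ) 1).inter_left (Submodule.closed_of_finiteDimensional V)
  have hφ_nonneg : ∀ u, 0 ≤ φ u := fun u => Finset.sum_nonneg fun i _ => le_max_left _ _
  obtain ⟨δ, hδ0, hδ⟩ : ∃ δ > 0, ∀ u ∈ K, δ ≤ φ u := by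
    rcases K.eq_empty_or_nonempty with h | h
    · exact ⟨1, one_pos, by simp [h]⟩
    · obtain ⟨u, hu, hmin⟩ := hKc.exists_isMinOn h hφc.continuousOn
      refine ⟨φ u, lt_of_le_of_ne (hφ_nonneg u) fun h0 => ?_, fun v hv => hmin hv⟩
      obtain ⟨⟨η, rfl⟩, hu1⟩ := hu
      have h1 := (Finset.sum_eq_zero_iff_of_nonneg fun i _ => le_max_left _ _).1 h0.symm
      have h2 : B.mulVec η = 0 := hB η fun i => by
        have := h1 i (Finset.mem_univ i)
        have h3 := le_max_right 0 (-(B.mulVecLin η i))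
        rw [this] at h3
        exact neg_nonpos.1 h3
      simp [h2] at hu1
  refine ⟨Fintype.card ι * |c| / δ, fun η hη i => ?_⟩
  set u := B.mulVec η with hu
  refine (norm_le_pi_norm u i).trans ?_
  rcases eq_or_ne u 0 with h0 | h0
  · rw [h0, norm_zero]; positivity
  have hn : 0 < ‖u‖ := norm_pos_iff.2 h0
  have h1 : δ ≤ φ (‖u‖⁻¹ • u) := by
    refine hδ _ ⟨V.smul_mem _ ⟨η, rfl⟩, ?_⟩
    rw [mem_sphere_zero_iff_norm, norm_smul, norm_inv, norm_norm, inv_mul_cancel₀ hn.ne']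
  have h2 : φ (‖u‖⁻¹ • u) ≤ ‖u‖⁻¹ * (Fintype.card ι * |c|) := by
    calc φ (‖u‖⁻¹ • u) ≤ ∑ _i : ι, ‖u‖⁻¹ * |c| := by
          refine Finset.sum_le_sum fun i _ => max_le (by positivity) ?_
          rw [Pi.smul_apply, smul_eq_mul, ← mul_neg]
          refine mul_le_mul_of_nonneg_left ?_ (by positivity)
          linarith [hη i, le_abs_self c]
      _ = _ := by rw [Finset.sum_const, nsmul_eq_mul, Finset.card_univ]; ring
  rw [le_div_iff₀ hδ0]
  have h3 := mul_le_mul_of_nonneg_left (h1.trans h2) hn.le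
  rwa [← mul_assoc, mul_inv_cancel₀ hn.ne', one_mul] at h3

theorem exists_minimizer_sum_exp_neg {ι κ : Type*} [Fintype ι] [Fintype κ]
    (B : Matrix ι κ ℝ) (hB : ∀ η, (∀ i, 0 ≤ B.mulVec η i) → B.mulVec η = 0) :
    ∃ ηs, ∀ η, ∑ i, Real.exp (-(B.mulVec ηs i)) ≤ ∑ i, Real.exp (-(B.mulVec η i)) := by
  classical
  set V := LinearMap.range B.mulVecLin with hV
  set f : (ι → ℝ) → ℝ := fun u => ∑ i, Real.exp (-u i) with hf
  have hfc : Continuous f := by fun_prop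
  set n : ℝ := (Fintype.card ι : ℝ) with hn
  set K : Set (ι → ℝ) := V ∩ {u | f u ≤ n} with hK
  obtain ⟨C, hC⟩ := exists_bound_abs_mulVec B hB (Real.log n)
  have hKcl : IsClosed K := (Submodule.closed_of_finiteDimensional V).inter
    (isClosed_le hfc continuous_const)
  have hKb : Bornology.IsBounded K := by
    refine (Metric.isBounded_closedBall (x := (0 : ι → ℝ)) (r := max C 0)).subset ?_
    rintro _ ⟨⟨η, rfl⟩, hη⟩
    rw [mem_closedBall_zero_iff, pi_norm_le_iff_of_nonneg (le_max_right _ _)]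
    refine fun i => (hC η (fun i => ?_) i).trans (le_max_left _ _)
    have h1 : Real.exp (-(B.mulVec η i)) ≤ n :=
      (Finset.single_le_sum (f := fun i => Real.exp (-(B.mulVec η i)))
        (fun i _ => (Real.exp_pos _).le) (Finset.mem_univ i)).trans hη
    have := (Real.le_log_iff_exp_le ((Real.exp_pos _).trans_le h1)).2 h1
    linarith
  -- The origin lies in the sublevel set, so the minimum over it is the global one.
  have h0 : (0 : ι → ℝ) ∈ K := ⟨V.zero_mem, by simp [hf, hn]⟩
  obtain ⟨u, ⟨⟨ηs, rfl⟩, hu⟩, hmin⟩ :=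
    (Metric.isCompact_of_isClosed_isBounded hKcl hKb).exists_isMinOn ⟨0, h0⟩ hfc.continuousOn
  refine ⟨ηs, fun η => ?_⟩
  by_cases hη : f (B.mulVec η) ≤ n
  · exact hmin (⟨⟨η, rfl⟩, hη⟩ : B.mulVec η ∈ K)
  · exact le_trans hu (not_le.1 hη).le

/-- There is a largest support `Z` of a nonnegative vector in the range of `M`, and it supports
all of them. -/
theorem exists_mulVec_pos_on {ι κ : Type*} [Fintype ι] [Fintype κ] (M : Matrix ι κ ℝ) :
    ∃ (Z : Finset ι) (η : κ → ℝ), (∀ i ∈ Z, 0 < M.mulVec η i) ∧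
      (∀ i ∉ Z, M.mulVec η i = 0) ∧
      ∀ ζ, (∀ i, 0 ≤ M.mulVec ζ i) → ∀ i ∉ Z, M.mulVec ζ i = 0 := by
  classical
  set P : ι → Prop := fun i => ∃ η, (∀ k, 0 ≤ M.mulVec η k) ∧ 0 < M.mulVec η i with hP
  have hF : ∀ ζ, (∀ i, 0 ≤ M.mulVec ζ i) → ∀ i, ¬ P i → M.mulVec ζ i = 0 := fun ζ hζ i hi =>
    le_antisymm (not_lt.1 fun h => hi ⟨ζ, hζ, h⟩) (hζ i)
  choose! η hη0 hηp using fun (i : ι) (h : P i) => h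
  have hsum : ∀ i, M.mulVec (∑ k with P k, η k) i = ∑ k with P k, M.mulVec (η k) i := fun i => by
    rw [← Matrix.mulVecLin_apply, map_sum, Finset.sum_apply]
    rfl
  have hnn : ∀ i, 0 ≤ M.mulVec (∑ k with P k, η k) i := fun i => by
    rw [hsum]
    exact Finset.sum_nonneg fun k hk => hη0 k (Finset.mem_filter.1 hk).2 i
  refine ⟨Finset.univ.filter P, ∑ k with P k, η k, fun i hi => ?_, fun i hi => ?_,
    fun ζ hζ i hi => hF ζ hζ i (by simpa using hi)⟩
  · rw [hsum]
    have hPi := (Finset.mem_filter.1 hi).2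
    exact Finset.sum_pos' (fun k hk => hη0 k (Finset.mem_filter.1 hk).2 i) ⟨i, hi, hηp i hPi⟩
  · exact hF _ hnn i (by simpa using hi)

theorem exists_isDecomposition (M : Matrix (Fin m) (Fin N) ℝ) :
    ∃ (Z : Finset (Fin m)) (γ μmax : ℝ), IsDecomposition M Z γ μmax := by
  classical
  obtain ⟨Z, η₀, hpos, hzero, hmax⟩ := exists_mulVec_pos_on M
  set B := restrictRows M Z with hBdef
  have hB : ∀ η, (∀ i, 0 ≤ B.mulVec η i) → B.mulVec η = 0 := by
    intro η hη
    -- Adding a large multiple of `η₀` makes all margins nonnegative without changing those in `F`.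
    have hc : ∀ᶠ c : ℝ in atTop, ∀ i ∈ Z, 0 ≤ M.mulVec η i + c * M.mulVec η₀ i := by
      rw [Filter.eventually_all_finset]
      intro i hi
      exact (tendsto_atTop_add_const_left _ _
        (tendsto_id.atTop_mul_const (hpos i hi))).eventually_ge_atTop 0
    obtain ⟨c, hc⟩ := hc.exists
    have hadd : ∀ i, M.mulVec (η + c • η₀) i = M.mulVec η i + c * M.mulVec η₀ i := fun i => by
      rw [Matrix.mulVec_add, Matrix.mulVec_smul]; rfl
    funext i
    have hi : i.1 ∉ Z := Finset.mem_compl.1 i.2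
    have := hmax (η + c • η₀) (fun k => ?_) i hi
    · rwa [hadd, hzero i hi, mul_zero, add_zero] at this
    · rw [hadd]
      by_cases hk : k ∈ Z
      · exact hc k hk
      · rw [hzero k hk, mul_zero, add_zero]
        exact hη ⟨k, Finset.mem_compl.2 hk⟩
  have hmargin : ∃ γ : ℝ, 0 < γ ∧ γ ≤ 1 ∧ (Z.Nonempty → ∃ η : Fin N → ℝ, ∑ k, |η k| = 1 ∧
      (∀ i ∈ Z, γ ≤ M.mulVec η i) ∧ ∀ i ∈ Zᶜ, M.mulVec η i = 0) := by
    rcases Z.eq_empty_or_nonempty with hZ | hZ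
    · exact ⟨1, one_pos, le_rfl, fun h => absurd hZ h.ne_empty⟩
    · have hnorm : 0 < ∑ k, |η₀ k| := by
        refine lt_of_le_of_ne (Finset.sum_nonneg fun _ _ => abs_nonneg _) fun h0 => ?_
        have h1 := (Finset.sum_eq_zero_iff_of_nonneg fun _ _ => abs_nonneg _).1 h0.symm
        obtain ⟨i, hi⟩ := hZ
        have h2 : η₀ = 0 := funext fun k => abs_eq_zero.1 (h1 k (Finset.mem_univ k))
        have := hpos i hi
        rw [h2, Matrix.mulVec_zero] at this
        exact lt_irrefl _ this
      set a := (∑ k, |η₀ k|)⁻¹ with ha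
      have ha0 : 0 < a := inv_pos.2 hnorm
      have hsmul : ∀ i, M.mulVec (a • η₀) i = a * M.mulVec η₀ i := fun i => by
        rw [Matrix.mulVec_smul]; rfl
      obtain ⟨i₀, hi₀, hmin⟩ := Z.exists_min_image (fun i => M.mulVec (a • η₀) i) hZ
      refine ⟨min 1 (M.mulVec (a • η₀) i₀), lt_min one_pos ?_, min_le_left _ _,
        fun _ => ⟨a • η₀, ?_, fun i hi => (min_le_right _ _).trans (hmin i hi), fun i hi => ?_⟩⟩
      · rw [hsmul]
        exact mul_pos ha0 (hpos _ hi₀)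
      · simp only [Pi.smul_apply, smul_eq_mul, abs_mul, abs_of_pos ha0]
        rw [← Finset.mul_sum, ha, inv_mul_cancel₀ hnorm.ne']
      · rw [hsmul, hzero i (Finset.mem_compl.1 hi), mul_zero]
  obtain ⟨γ, hγ0, hγ1, hmar⟩ := hmargin
  obtain ⟨ηs, hηs⟩ := exists_minimizer_sum_exp_neg B hB
  obtain ⟨C, hC⟩ := exists_bound_abs_mulVec B hB (Real.log m)
  refine ⟨Z, γ, max C 0, hγ0, hγ1, le_max_right _ _, hmar, ⟨ηs, fun η => ?_⟩, fun η hη => ?_⟩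
  · rw [← Finset.sum_coe_sort, ← Finset.sum_coe_sort Zᶜ]
    exact hηs η
  · have hlow : ∀ i ∈ Zᶜ, -Real.log m ≤ M.mulVec η i := fun i hi => by
      have h1 : Real.exp (-(M.mulVec η i)) ≤ m :=
        (Finset.single_le_sum (f := fun i => exampleLoss M η i)
          (fun i _ => (Real.exp_pos _).le) hi).trans hη
      have := (Real.le_log_iff_exp_le ((Real.exp_pos _).trans_le h1)).2 h1
      linarith
    exact fun i hi => ⟨hlow i hi, (le_abs_self _).trans
      ((hC η (fun k => hlow k k.2) ⟨i, hi⟩).trans (le_max_left _ _))⟩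

end AdaBoost

/-- AdaBoost with (confidence-rated) feature matrix `M` reaches within `ε` of the infimal
exponential loss in at most `C / ε` rounds, where `C` depends only on `M`; the data of a
decomposition into zero-loss and finite-margin set exist, and for any such data
`C = 32 m³ N e^{μmax} / (γ² λ_min²)` is a valid constant. -/
theorem mainTheorem3 {m N : ℕ} (hm : 0 < m) (hN : 0 < N)
    (M : Matrix (Fin m) (Fin N) ℝ) (hM : ∀ i k, |M i k| ≤ 1) :
    (∃ C : ℝ, 0 < C ∧ AdaBoost.ReachesOptimumWithin M C) ∧
    (∃ (Z : Finset (Fin m)) (γ μmax : ℝ), AdaBoost.IsDecomposition M Z γ μmax) ∧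
    (∀ (Z : Finset (Fin m)) (γ μmax : ℝ), AdaBoost.IsDecomposition M Z γ μmax →
      AdaBoost.ReachesOptimumWithin M
        (32 * (m : ℝ) ^ 3 * (N : ℝ) * Real.exp μmax /
          (γ ^ 2 * AdaBoost.lambdaMinSq M Z))) := by
  have hrate := fun (Z : Finset (Fin m)) (γ μmax : ℝ) (h : AdaBoost.IsDecomposition M Z γ μmax) =>
    h.reachesOptimumWithin hm hN hM
  obtain ⟨Z, γ, μmax, h⟩ := AdaBoost.exists_isDecomposition M
  refine ⟨⟨_, ?_, hrate Z γ μmax h⟩, ⟨Z, γ, μmax, h⟩, hrate⟩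
  have hγ := h.gamma_pos
  have hlm := AdaBoost.lambdaMinSq_pos M Z
  positivity
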